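/- Let $n\ge 1$ be an integer and $s>0$. Let $$G_s(x)=\frac{(2\sqrt{\pi})^{-n}}{\Gamma(s/2)}\int_0^\infty e^{-t}e^{-|x|^2/(4t)}\,t^{(s-n)/2}\,\frac{dt}{t}\qquad(x\in\mathbb{R}^n)$$ be the Bessel kernel, so that $(I-\Delta)^{-s/2}f=G_s*f$. For $1<p<\infty$ let $$H^{s,p}(\mathbb{R}^n)=\{u:\ u=G_s*f \text{ a.e. for some } f\in L^p(\mathbb{R}^n)\},\qquad \|u\|_{H^{s,p}(\mathbb{R}^n)}=\|f\|_{L^p(\mathbb{R}^n)}\ \text{ if } u=G_s*f,$$ and let $H^{s,p}_{rad}(\mathbb{R}^n)$ be the subspace of those $u\in H^{s,p}(\mathbb{R}^n)$ that are radial, i.e. $u(x)=u_0(|x|)$ for almost every $x$ and some function $u_0$. **Theorem.** Let $1<p<\infty$, $0<s<\frac{n}{p}$, $p\le r\le p^*_c:=\frac{p(n+c)}{n-sp}$ and $$-sp<c<\frac{(n-1)(r-p)}{p}.$$ Then there is a continuous embedding $$H^{s,p}_{rad}(\mathbb{R}^n)\subset L^r(\mathbb{R}^n,|x|^c\,dx),$$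 that is, there is a constant $C$, depending only on $n,p,s,r,c$, such that every $u\in H^{s,p}_{rad}(\mathbb{R}^n)$ belongs to $L^r(\mathbb{R}^n,|x|^c\,dx)$ and $$\left(\int_{\mathbb{R}^n}|u(x)|^r|x|^c\,dx\right)^{1/r}\le C\,\|u\|_{H^{s,p}(\mathbb{R}^n)}.$$ -/

import Mathlib

open MeasureTheory Set
open scoped ENNReal NNReal Convolution

noncomputable section

/-- The Bessel kernel `G_s` on `ℝⁿ`, i.e. the convolution kernel of `(I - Δ)^{-s/2}`:
`G_s(x) = (2√π)^{-n} / Γ(s/2) * ∫_0^∞ e^{-t} e^{-|x|²/(4t)} t^{(s-n)/2} dt/t`. -/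
def besselKernel (n : ℕ) (s : ℝ) (x : EuclideanSpace ℝ (Fin n)) : ℝ :=
  ((2 * √Real.pi) ^ n)⁻¹ / Real.Gamma (s / 2) *
    ∫ t in Ioi (0 : ℝ), Real.exp (-t) * Real.exp (-‖x‖ ^ 2 / (4 * t)) * t ^ ((s - n) / 2) / t

/-- The operator `(I - Δ)^{-s/2} f = G_s * f` (convolution over `ℝⁿ` with Lebesgue measure). -/
def besselPotential (n : ℕ) (s : ℝ) (f : EuclideanSpace ℝ (Fin n) → ℂ) :
    EuclideanSpace ℝ (Fin n) → ℂ :=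
  besselKernel n s ⋆[ContinuousLinearMap.lsmul ℝ ℝ, volume] f

/-- The potential space `H^{s,p}(ℝⁿ)`: the functions that agree almost everywhere with `G_s * f`
for some `f ∈ L^p(ℝⁿ)`. -/
def potentialSpace (n : ℕ) (s : ℝ) (p : ℝ≥0∞) : Set (EuclideanSpace ℝ (Fin n) → ℂ) :=
  {u | ∃ f : EuclideanSpace ℝ (Fin n) → ℂ, MemLp f p volume ∧ u =ᵐ[volume] besselPotential n s f}

/-- The norm of `H^{s,p}(ℝⁿ)`: `‖u‖_{H^{s,p}} = ‖f‖_{L^p}` where `u = G_s * f`. As `f` is determined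
by `u` up to a null set, the infimum runs over the representatives of one class in `L^p`. It is
`∞` when `u` is not in the space. -/
def potentialNorm (n : ℕ) (s : ℝ) (p : ℝ≥0∞) (u : EuclideanSpace ℝ (Fin n) → ℂ) : ℝ≥0∞ :=
  ⨅ (f : EuclideanSpace ℝ (Fin n) → ℂ) (_ : MemLp f p volume)
    (_ : u =ᵐ[volume] besselPotential n s f), eLpNorm f p volume

/-- `u` is radial: `u(x) = u₀(|x|)` for almost every `x`. -/
def IsRadial {n : ℕ} (u : EuclideanSpace ℝ (Fin n) → ℂ) : Prop :=
  ∃ u₀ : ℝ → ℂ, u =ᵐ[volume] fun x => u₀ ‖x‖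

/-- `H^{s,p}_rad(ℝⁿ)`, the radial elements of `H^{s,p}(ℝⁿ)`. -/
def radialPotentialSpace (n : ℕ) (s : ℝ) (p : ℝ≥0∞) : Set (EuclideanSpace ℝ (Fin n) → ℂ) :=
  {u | u ∈ potentialSpace n s p ∧ IsRadial u}

/-- The measure `|x|^c dx` on `ℝⁿ`. -/
def powerWeight (n : ℕ) (c : ℝ) : Measure (EuclideanSpace ℝ (Fin n)) :=
  volume.withDensity fun x => ENNReal.ofReal (‖x‖ ^ c)

end

/-! Put `σ = n/p - (n+c)/r`, the order for which the Riesz potential obeys the scaling of the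
weighted estimate. The bound `r ≤ p*_c` says `σ ≤ s`, so `G_s(x) ≤ C|x|^(σ-n)` and `|u|` is
dominated by a Riesz potential of `|f|`.

Since `u` is radial (`f` need not be), this bound may be averaged over spheres. Averaging tames the
singularity: for `γ + δ = n - σ` the mean of `|x-y|^(σ-n)` over `|x| = R` is at most a constant
times `|R-ρ|^(-γ) max(R,ρ)^(-δ)`, `ρ = |y|`, with `γ` as small as the sphere's dimension allows
(`lintegral_toSphere_le_radialKernel`).

After insertion of powers of `|x|` and `|y|` the kernel is homogeneous of degree zero. Young's
inequality for the dilation-invariant measure `|x|^(-n) dx` (`lintegral_rpow_lintegral_mul_le`) then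
applies once `γ < 1 + 1/r - 1/p`. Such a `γ` exists when `σ > 1/p - 1/r`, which is exactly `c <
(n-1)(r-p)/p`. -/

theorem ENNReal.rpow_le_rpow_of_nonpos {a b : ℝ≥0∞} {z : ℝ} (hz : z ≤ 0) (h : a ≤ b) :
    b ^ z ≤ a ^ z := by
  rw [← neg_neg z, ENNReal.rpow_neg b, ENNReal.rpow_neg a, ENNReal.inv_le_inv]
  exact ENNReal.rpow_le_rpow h (by linarith)

/-! ### Power bounds for the Bessel kernel -/

theorem Real.rpow_le_mul_exp {t e : ℝ} (ht : 0 ≤ t) (he : 0 ≤ e) :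
    t ^ e ≤ (e + 1) ^ e * Real.exp t := by
  have h1 : t / (e + 1) ≤ Real.exp (t / (e + 1)) := by
    linarith [Real.add_one_le_exp (t / (e + 1))]
  have h2 : t ≤ (e + 1) * Real.exp (t / (e + 1)) := by
    rw [div_le_iff₀ (by positivity)] at h1
    linarith
  calc t ^ e ≤ ((e + 1) * Real.exp (t / (e + 1))) ^ e := by gcongr
    _ = (e + 1) ^ e * Real.exp (t / (e + 1) * e) := by
        rw [Real.mul_rpow (by positivity) (by positivity), ← Real.exp_mul]
    _ ≤ (e + 1) ^ e * Real.exp t := by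
        gcongr
        rw [div_mul_eq_mul_div, div_le_iff₀ (by positivity)]
        nlinarith

theorem Real.exp_neg_le_mul_rpow_neg {t e : ℝ} (ht : 0 < t) (he : 0 ≤ e) :
    Real.exp (-t) ≤ (e + 1) ^ e * t ^ (-e) := by
  have := Real.rpow_le_mul_exp ht.le he
  rw [Real.exp_neg, Real.rpow_neg ht.le, ← div_eq_mul_inv, le_div_iff₀ (by positivity),
    inv_mul_le_iff₀ (Real.exp_pos t)]
  linarith

/-- Near `0` the exponential beats every power; at infinity the exponent is below `-1`. -/
theorem integrableOn_exp_neg_inv_mul_rpow {a : ℝ} (ha : 0 < a) :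
    IntegrableOn (fun t : ℝ => Real.exp (-(1 / (4 * t))) * t ^ (-a - 1)) (Ioi 0) := by
  have hm : Measurable fun t : ℝ => Real.exp (-(1 / (4 * t))) * t ^ (-a - 1) := by fun_prop
  rw [← Ioc_union_Ioi_eq_Ioi zero_le_one, integrableOn_union]
  constructor
  · refine Measure.integrableOn_of_bounded (M := (a + 1 + 1) ^ (a + 1) * 4 ^ (a + 1)) (by simp)
      hm.aestronglyMeasurable ?_
    filter_upwards [ae_restrict_mem measurableSet_Ioc] with t ht
    have ht0 : 0 < t := ht.1
    rw [Real.norm_of_nonneg (by positivity)]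
    have := Real.exp_neg_le_mul_rpow_neg (t := 1 / (4 * t)) (e := a + 1) (by positivity)
      (by linarith)
    calc _ ≤ (a + 1 + 1) ^ (a + 1) * (1 / (4 * t)) ^ (-(a + 1)) * t ^ (-a - 1) := by gcongr
      _ = _ := by
        rw [one_div, Real.inv_rpow (by positivity), ← Real.rpow_neg (by positivity), neg_neg,
          Real.mul_rpow (by norm_num) ht0.le, mul_assoc, mul_assoc, ← Real.rpow_add ht0,
          show a + 1 + (-a - 1) = 0 by ring, Real.rpow_zero, mul_one]
  · refine (integrableOn_Ioi_rpow_of_lt (a := -a - 1) (by linarith) one_pos).mono'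
      hm.aestronglyMeasurable ?_
    filter_upwards [ae_restrict_mem measurableSet_Ioi] with t ht
    have ht0 : 0 < t := one_pos.trans ht
    rw [Real.norm_of_nonneg (by positivity)]
    refine mul_le_of_le_one_left (by positivity) ?_
    rw [Real.exp_le_one_iff]
    simp only [Left.neg_nonpos_iff]
    positivity

/-- Bounding `e^(-t)` by a multiple of `t^(-(s-s')/2)` lowers the order from `s` to `s'` and leaves
a homogeneous integral; rescaling `t` by `‖x‖²` extracts the power of `‖x‖`. -/
theorem abs_besselKernel_le {n : ℕ} {s s' : ℝ} (hs : s' ≤ s) (hn : s' < n) :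
    ∃ C : ℝ≥0, ∀ x : EuclideanSpace ℝ (Fin n), x ≠ 0 →
      |besselKernel n s x| ≤ C * ‖x‖ ^ (s' - n) := by
  set a : ℝ := (n - s') / 2 with ha
  have ha0 : 0 < a := by rw [ha]; linarith
  set ψ : ℝ → ℝ := fun t => Real.exp (-(1 / (4 * t))) * t ^ (-a - 1) with hψ
  have hψi := integrableOn_exp_neg_inv_mul_rpow ha0
  set e : ℝ := (s - s') / 2 with he
  have he0 : 0 ≤ e := by rw [he]; linarith
  set M : ℝ := (e + 1) ^ e with hM
  have hM0 : 0 ≤ M := by positivity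
  set I := ∫ t in Ioi (0 : ℝ), ψ t with hI
  have hI0 : 0 ≤ I := by
    refine setIntegral_nonneg measurableSet_Ioi fun t ht => ?_
    have : (0 : ℝ) < t := ht
    positivity
  refine ⟨Real.toNNReal (|((2 * √Real.pi) ^ n)⁻¹ / Real.Gamma (s / 2)| * (M * I)), fun x hx => ?_⟩
  rw [Real.coe_toNNReal _ (by positivity)]
  have hR : 0 < ‖x‖ := norm_pos_iff.2 hx
  set R := ‖x‖
  have hb : 0 < (R ^ 2)⁻¹ := by positivity
  have hφi : IntegrableOn (fun t => M * (R ^ 2) ^ (-a - 1) * ψ ((R ^ 2)⁻¹ * t)) (Ioi 0) := by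
    refine Integrable.const_mul ?_ _
    have := (integrableOn_Ioi_comp_mul_left_iff ψ 0 hb).2 (by rw [mul_zero]; exact hψi)
    exact this
  have hle : |∫ t in Ioi (0 : ℝ), Real.exp (-t) * Real.exp (-R ^ 2 / (4 * t)) *
      t ^ ((s - n) / 2) / t| ≤ M * I * R ^ (s' - n) := by
    rw [abs_of_nonneg]
    · calc _ ≤ ∫ t in Ioi (0 : ℝ), M * (R ^ 2) ^ (-a - 1) * ψ ((R ^ 2)⁻¹ * t) := by
            refine integral_mono_of_nonneg ?_ hφi ?_
            · filter_upwards [ae_restrict_mem measurableSet_Ioi] with t ht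
              have : (0 : ℝ) < t := ht
              simp only [Pi.zero_apply]
              positivity
            · filter_upwards [ae_restrict_mem measurableSet_Ioi] with t ht
              have ht : (0 : ℝ) < t := ht
              have h1 := Real.exp_neg_le_mul_rpow_neg ht he0
              simp only [hψ]
              rw [Real.mul_rpow hb.le ht.le, Real.inv_rpow (by positivity)]
              have h2 : (R ^ 2) ^ (-a - 1) ≠ 0 := by positivity
              have h3 : -(1 / (4 * ((R ^ 2)⁻¹ * t))) = -R ^ 2 / (4 * t) := by field_simp
              have h4 : t ^ ((s - n) / 2) / t * t ^ (-e) = t ^ (-a - 1) := by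
                rw [← Real.rpow_sub_one ht.ne', ← Real.rpow_add ht]
                congr 1
                rw [ha, he]; ring
              rw [h3, ← h4]
              calc _ = Real.exp (-t) * (Real.exp (-R ^ 2 / (4 * t)) * t ^ ((s - n) / 2) / t) := by
                    ring
                _ ≤ (M * t ^ (-e)) * (Real.exp (-R ^ 2 / (4 * t)) * t ^ ((s - n) / 2) / t) := by
                    gcongr
                _ = _ := by field_simp
        _ = M * I * R ^ (s' - n) := by
            rw [integral_const_mul, integral_comp_mul_left_Ioi ψ 0 hb, mul_zero, smul_eq_mul,
              inv_inv, ← hI]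
            have : (R ^ 2) ^ (-a - 1) * R ^ 2 = R ^ (s' - n) := by
              rw [← Real.rpow_natCast R 2, ← Real.rpow_mul hR.le, ← Real.rpow_add hR]
              congr 1
              rw [ha]; push_cast; ring
            rw [← this]; ring
    · refine setIntegral_nonneg measurableSet_Ioi fun t ht => ?_
      have : (0 : ℝ) < t := ht
      positivity
  rw [besselKernel, abs_mul, mul_assoc]
  gcongr

theorem enorm_besselKernel_le {n : ℕ} {s s' : ℝ} (hs : s' ≤ s) (hn : s' < n) :
    ∃ C : ℝ≥0, ∀ x : EuclideanSpace ℝ (Fin n),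
      ‖besselKernel n s x‖ₑ ≤ (C + 1 : ℝ≥0) * ‖x‖ₑ ^ (s' - n) := by
  obtain ⟨C, hC⟩ := abs_besselKernel_le hs hn
  -- The summand `1` keeps the constant nonzero, so that the right side is `∞` at `x = 0`.
  refine ⟨C, fun x => ?_⟩
  rcases eq_or_ne x 0 with rfl | hx
  · rw [enorm_zero, ENNReal.zero_rpow_of_neg (by linarith), ENNReal.mul_top (by simp)]
    exact le_top
  · rw [← ofReal_norm x, ENNReal.ofReal_rpow_of_pos (norm_pos_iff.2 hx),
      ← ENNReal.ofReal_coe_nnreal, ← ENNReal.ofReal_mul (by positivity), ← ofReal_norm]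
    refine ENNReal.ofReal_le_ofReal ((hC x hx).trans ?_)
    gcongr
    simp

theorem measurable_besselKernel (n : ℕ) (s : ℝ) : Measurable (besselKernel n s) := by
  refine Measurable.const_mul (StronglyMeasurable.measurable ?_) _
  refine StronglyMeasurable.integral_prod_right (f := fun (x : EuclideanSpace ℝ (Fin n)) (t : ℝ) =>
    Real.exp (-t) * Real.exp (-‖x‖ ^ 2 / (4 * t)) * t ^ ((s - n) / 2) / t) ?_
  exact Measurable.stronglyMeasurable (by fun_prop)

/-! ### Young's inequality for integral operators -/

section SchurYoung

variable {X Y : Type*} [MeasurableSpace X] [MeasurableSpace Y] {μ : Measure X} {ν : Measure Y}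
  [SFinite μ] [SFinite ν]

/-- Young's inequality for integral operators. -/
theorem lintegral_rpow_lintegral_mul_le {p q m : ℝ} (hp : 1 < p) (hpq : p ≤ q)
    (hm : 1 / m = 1 + 1 / q - 1 / p) {K : X → Y → ℝ≥0∞} (hK : Measurable (Function.uncurry K))
    {h : Y → ℝ≥0∞} (hh : Measurable h) {B : ℝ≥0∞}
    (hB₁ : ∀ᵐ x ∂μ, ∫⁻ y, K x y ^ m ∂ν ≤ B) (hB₂ : ∀ᵐ y ∂ν, ∫⁻ x, K x y ^ m ∂μ ≤ B) :
    ∫⁻ x, (∫⁻ y, K x y * h y ∂ν) ^ q ∂μ ≤ B ^ (q / m) * (∫⁻ y, h y ^ p ∂ν) ^ (q / p) := by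
  have hp0 : 0 < p := by linarith
  have hq0 : 0 < q := by linarith
  have hp1 : 1 / p < 1 := by rw [div_lt_one hp0]; exact hp
  have hqp : 1 / q ≤ 1 / p := one_div_le_one_div_of_le hp0 hpq
  have hq' : 0 < 1 / q := by positivity
  have hm' : 0 < 1 / m := by linarith
  have hm0 : 0 < m := one_div_pos.1 hm'
  have hm1 : 1 / m ≤ 1 := by linarith
  set H := ∫⁻ y, h y ^ p ∂ν with hH
  -- The exponents `1/q`, `1 - 1/p`, `1 - 1/m` sum to `1` by `hm`, so Hölder with three factors
  -- applies; the last two factors are controlled by `B` and `H`.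
  have hpt : ∀ k z : ℝ≥0∞, k * z =
      (k ^ m * z ^ p) ^ (1 / q) * ((k ^ m) ^ (1 - 1 / p) * (z ^ p) ^ (1 - 1 / m)) := by
    intro k z
    rw [ENNReal.mul_rpow_of_nonneg _ _ hq'.le, ← ENNReal.rpow_mul, ← ENNReal.rpow_mul,
      ← ENNReal.rpow_mul, ← ENNReal.rpow_mul, mul_mul_mul_comm,
      ← ENNReal.rpow_add_of_nonneg _ _ (by positivity) (mul_nonneg hm0.le (by linarith)),
      ← ENNReal.rpow_add_of_nonneg _ _ (by positivity) (mul_nonneg hp0.le (by linarith)),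
      ← mul_add, ← mul_add, show 1 / q + (1 - 1 / p) = 1 / m by linarith,
      show 1 / q + (1 - 1 / m) = 1 / p by linarith, mul_one_div_cancel hm0.ne',
      mul_one_div_cancel hp0.ne', ENNReal.rpow_one, ENNReal.rpow_one]
  have hx : ∀ᵐ x ∂μ, (∫⁻ y, K x y * h y ∂ν) ^ q ≤
      (B ^ (q * (1 - 1 / p)) * H ^ (q * (1 - 1 / m))) * ∫⁻ y, K x y ^ m * h y ^ p ∂ν := by
    filter_upwards [hB₁] with x hx
    have hKx : Measurable (K x) := hK.of_uncurry_left
    have := ENNReal.lintegral_mul_prod_norm_pow_le (μ := ν) (Finset.univ : Finset (Fin 2))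
      (g := fun y => K x y ^ m * h y ^ p) (f := ![fun y => K x y ^ m, fun y => h y ^ p])
      (by fun_prop) (by
        intro i _
        fin_cases i
        · simpa using (hKx.pow_const m).aemeasurable
        · simpa using (hh.pow_const p).aemeasurable) (1 / q) (p := ![1 - 1 / p, 1 - 1 / m])
      (by simp [Fin.sum_univ_two, -one_div]; linarith) hq'.le (by
        intro i _
        fin_cases i <;> simp [-one_div] <;> linarith)
    simp only [Fin.prod_univ_two, Matrix.cons_val_zero, Matrix.cons_val_one] at this
    calc (∫⁻ y, K x y * h y ∂ν) ^ q ≤ ((∫⁻ y, K x y ^ m * h y ^ p ∂ν) ^ (1 / q) *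
          ((∫⁻ y, K x y ^ m ∂ν) ^ (1 - 1 / p) * (∫⁻ y, h y ^ p ∂ν) ^ (1 - 1 / m))) ^ q := by
          refine ENNReal.rpow_le_rpow ?_ hq0.le
          refine le_trans (le_of_eq ?_) this
          exact lintegral_congr fun y => hpt _ _
      _ ≤ ((∫⁻ y, K x y ^ m * h y ^ p ∂ν) ^ (1 / q) *
          (B ^ (1 - 1 / p) * H ^ (1 - 1 / m))) ^ q := by
          gcongr
      _ = _ := by
          rw [ENNReal.mul_rpow_of_nonneg _ _ hq0.le, ENNReal.mul_rpow_of_nonneg _ _ hq0.le,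
            ← ENNReal.rpow_mul, ← ENNReal.rpow_mul, ← ENNReal.rpow_mul,
            one_div_mul_cancel hq0.ne', ENNReal.rpow_one, mul_comm q, mul_comm q, mul_comm]
  have hKm : Measurable fun z : X × Y => K z.1 z.2 ^ m := hK.pow_const m
  calc ∫⁻ x, (∫⁻ y, K x y * h y ∂ν) ^ q ∂μ
      ≤ ∫⁻ x, (B ^ (q * (1 - 1 / p)) * H ^ (q * (1 - 1 / m))) *
          ∫⁻ y, K x y ^ m * h y ^ p ∂ν ∂μ := lintegral_mono_ae hx
    _ = (B ^ (q * (1 - 1 / p)) * H ^ (q * (1 - 1 / m))) *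
          ∫⁻ y, (∫⁻ x, K x y ^ m ∂μ) * h y ^ p ∂ν := by
        have hmeas : Measurable fun z : X × Y => K z.1 z.2 ^ m * h z.2 ^ p := by fun_prop
        rw [lintegral_const_mul _ hmeas.lintegral_prod_right',
          lintegral_lintegral_swap hmeas.aemeasurable]
        congr 1
        refine lintegral_congr fun y => ?_
        exact lintegral_mul_const (h y ^ p) (hKm.comp (measurable_prodMk_right (y := y)))
    _ ≤ (B ^ (q * (1 - 1 / p)) * H ^ (q * (1 - 1 / m))) * ∫⁻ y, B * h y ^ p ∂ν := by
        refine mul_le_mul_right (lintegral_mono_ae ?_) _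
        filter_upwards [hB₂] with y hy
        gcongr
    _ = _ := by
        rw [lintegral_const_mul _ (hh.pow_const p), ← hH, mul_mul_mul_comm]
        congr 1
        · nth_rewrite 2 [← ENNReal.rpow_one B]
          rw [← ENNReal.rpow_add_of_nonneg _ _ (mul_nonneg hq0.le (by linarith)) zero_le_one]
          congr 1
          rw [div_eq_mul_one_div q m, hm]; field_simp; ring
        · nth_rewrite 2 [← ENNReal.rpow_one H]
          rw [← ENNReal.rpow_add_of_nonneg _ _ (mul_nonneg hq0.le (by linarith)) zero_le_one]
          congr 1
          rw [hm]; field_simp; ring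

end SchurYoung

/-! ### Polar coordinates and integrals over spheres -/

section Polar

open Module Metric

variable {E : Type*} [NormedAddCommGroup E] [NormedSpace ℝ E] [FiniteDimensional ℝ E]
  [MeasurableSpace E] [BorelSpace E] (μ : Measure E) [μ.IsAddHaarMeasure]

theorem lintegral_polar [Nontrivial E] {f : E → ℝ≥0∞} (hf : Measurable f) :
    ∫⁻ x, f x ∂μ = ∫⁻ r in Ioi (0 : ℝ), ENNReal.ofReal (r ^ (finrank ℝ E - 1)) *
      ∫⁻ ω : sphere (0 : E) 1, f (r • (ω : E)) ∂μ.toSphere := by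
  have h1 : ∫⁻ x, f x ∂μ = ∫⁻ x : ({(0)}ᶜ : Set E), f x ∂(μ.comap (↑)) := by
    rw [lintegral_subtype_comap (measurableSet_singleton _).compl f, restrict_compl_singleton]
  have hmp := μ.measurePreserving_homeomorphUnitSphereProd
  have hfm : Measurable fun z : sphere (0 : E) 1 × Ioi (0 : ℝ) => f ((z.2 : ℝ) • (z.1 : E)) := by
    fun_prop
  have h2 : ∫⁻ x : ({(0)}ᶜ : Set E), f x ∂(μ.comap (↑)) =
      ∫⁻ z : sphere (0 : E) 1 × Ioi (0 : ℝ), f ((z.2 : ℝ) • (z.1 : E))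
        ∂(μ.toSphere.prod (Measure.volumeIoiPow (finrank ℝ E - 1))) := by
    rw [← hmp.lintegral_comp hfm]
    refine lintegral_congr fun x => ?_
    congr 1
    have := congrArg Subtype.val ((homeomorphUnitSphereProd E).symm_apply_apply x)
    rw [homeomorphUnitSphereProd_symm_apply_coe] at this
    exact this.symm
  rw [h1, h2, lintegral_prod_symm _ hfm.aemeasurable, Measure.volumeIoiPow,
    lintegral_withDensity_eq_lintegral_mul _ (by fun_prop) hfm.lintegral_prod_left']
  exact lintegral_subtype_comap measurableSet_Ioi (fun r : ℝ =>
    ENNReal.ofReal (r ^ (finrank ℝ E - 1)) *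
      ∫⁻ ω : sphere (0 : E) 1, f (r • (ω : E)) ∂μ.toSphere)

theorem lintegral_fun_norm [Nontrivial E] {f : ℝ → ℝ≥0∞} (hf : Measurable f) :
    ∫⁻ x, f ‖x‖ ∂μ = μ.toSphere univ *
      ∫⁻ r in Ioi (0 : ℝ), ENNReal.ofReal (r ^ (finrank ℝ E - 1)) * f r := by
  rw [lintegral_polar μ (f := fun x => f ‖x‖) (by fun_prop), ← lintegral_const_mul _ (by fun_prop)]
  refine setLIntegral_congr_fun measurableSet_Ioi fun r hr => ?_
  have hr : 0 < r := hr
  have : ∀ ω : sphere (0 : E) 1, ‖r • (ω : E)‖ = r := fun ω => by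
    simp [norm_smul, abs_of_pos hr]
  simp only [this, lintegral_const]
  ring

/-- A radial function that is a.e. dominated by `v` is a.e. dominated by the spherical
means of `v`. -/
theorem ae_mul_le_lintegral_toSphere [Nontrivial E] {w : ℝ → ℝ≥0∞} {v : E → ℝ≥0∞}
    (h : ∀ᵐ x ∂μ, w ‖x‖ ≤ v x) :
    ∀ᵐ x ∂μ, μ.toSphere univ * w ‖x‖ ≤
      ∫⁻ ω : sphere (0 : E) 1, v (‖x‖ • (ω : E)) ∂μ.toSphere := by
  have hmp := μ.measurePreserving_homeomorphUnitSphereProd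
  have hs0 : MeasurableSet ({(0 : E)}ᶜ : Set E) := (measurableSet_singleton _).compl
  have h1 : ∀ᵐ x : ({(0 : E)}ᶜ : Set E) ∂(μ.comap (↑)), w ‖(x : E)‖ ≤ v x :=
    (ae_restrict_iff_subtype hs0).1 (ae_restrict_of_ae h)
  have h2 : ∀ᵐ z ∂(μ.toSphere.prod (Measure.volumeIoiPow (finrank ℝ E - 1))),
      w (z.2 : ℝ) ≤ v ((z.2 : ℝ) • (z.1 : E)) := by
    have h3 := (hmp.symm (homeomorphUnitSphereProd E).toMeasurableEquiv).quasiMeasurePreserving.ae h1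
    filter_upwards [h3] with z hz
    have h4 : (((homeomorphUnitSphereProd E).toMeasurableEquiv.symm z : ({(0 : E)}ᶜ : Set E)) : E) =
        (z.2 : ℝ) • (z.1 : E) := homeomorphUnitSphereProd_symm_apply_coe E z
    rw [h4] at hz
    have h5 : ‖(z.2 : ℝ) • (z.1 : E)‖ = z.2 := by
      have : (0 : ℝ) < z.2 := z.2.2
      simp [norm_smul, abs_of_pos this]
    rwa [h5] at hz
  -- Slicing the null set by Fubini leaves `w` constant on almost every sphere, so `w` need not be
  -- measurable.
  have h3 : ∀ᵐ r : Ioi (0 : ℝ) ∂(Measure.volumeIoiPow (finrank ℝ E - 1)),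
      ∀ᵐ ω : sphere (0 : E) 1 ∂μ.toSphere,
      w (r : ℝ) ≤ v ((r : ℝ) • (ω : E)) := by
    refine Measure.ae_ae_of_ae_prod (p := fun z : Ioi (0 : ℝ) × sphere (0 : E) 1 =>
      w (z.1 : ℝ) ≤ v ((z.1 : ℝ) • (z.2 : E))) ?_
    exact (Measure.measurePreserving_swap (μ := Measure.volumeIoiPow (finrank ℝ E - 1))
      (ν := μ.toSphere)).quasiMeasurePreserving.ae h2
  have h4 : ∀ᵐ r : Ioi (0 : ℝ) ∂(Measure.volumeIoiPow (finrank ℝ E - 1)),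
      μ.toSphere univ * w (r : ℝ) ≤
      ∫⁻ ω : sphere (0 : E) 1, v ((r : ℝ) • (ω : E)) ∂μ.toSphere := by
    filter_upwards [h3] with r hr
    rw [mul_comm, ← lintegral_const]
    exact lintegral_mono_ae hr
  have h5 := (hmp.quasiMeasurePreserving.ae
    (Measure.quasiMeasurePreserving_snd (μ := μ.toSphere).ae h4))
  simp only [homeomorphUnitSphereProd_apply_snd_coe] at h5
  have h6 := (ae_restrict_iff_subtype hs0 (p := fun x : E => μ.toSphere univ * w ‖x‖ ≤
      ∫⁻ ω : sphere (0 : E) 1, v (‖x‖ • (ω : E)) ∂μ.toSphere)).2 h5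
  rwa [restrict_compl_singleton] at h6

theorem lintegral_ball_enorm_sub_rpow_neg (hE : 0 < finrank ℝ E) {β : ℝ}
    (hβ : β < finrank ℝ E) (R : ℝ) :
    ∃ C : ℝ≥0∞, C ≠ ∞ ∧ ∀ e : E, ∫⁻ z in ball e R, ‖z - e‖ₑ ^ (-β) ∂μ = C := by
  have : Nontrivial E := nontrivial_of_finrank_pos hE
  refine ⟨∫⁻ z in ball 0 R, ‖z‖ₑ ^ (-β) ∂μ, ?_, fun e => ?_⟩
  · have h1 := integrableOn_ball_of_norm_le_rpow (μ := μ) (f := fun x : E => ‖x‖ ^ (-β)) (C := 1)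
      (r := R) (α := β) hE hβ (by
        filter_upwards with x
        rw [Real.norm_of_nonneg (by positivity), one_mul])
      (Measurable.aestronglyMeasurable (by fun_prop))
    have h2 := h1.lintegral_lt_top
    refine ne_of_lt (lt_of_le_of_lt (le_of_eq (lintegral_congr_ae ?_)) h2)
    filter_upwards [ae_restrict_of_ae (Measure.ae_ne μ (0 : E))] with x hx
    rw [← ofReal_norm x, ENNReal.ofReal_rpow_of_pos (norm_pos_iff.2 hx)]
  · rw [← lintegral_indicator measurableSet_ball, ← lintegral_indicator measurableSet_ball,

      ← lintegral_sub_right_eq_self ((ball 0 R).indicator fun z => ‖z‖ₑ ^ (-β)) e]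
    refine lintegral_congr fun z => ?_
    simp only [indicator, mem_ball, dist_eq_norm, sub_zero]

/-- The sphere has dimension one less than `E`. Thickening it radially turns the exponent `δ` into
`δ + 1`, which is locally integrable in `E`, and translation invariance makes the bound uniform in
`e`. The case `δ = 0` is kept apart to include dimension one. -/
theorem lintegral_toSphere_enorm_sub_rpow_neg {δ : ℝ} (hδ0 : 0 ≤ δ)
    (hδ : δ = 0 ∨ δ < finrank ℝ E - 1) :
    ∃ C : ℝ≥0∞, C ≠ ∞ ∧ ∀ e : sphere (0 : E) 1,
      ∫⁻ ω : sphere (0 : E) 1, ‖(ω : E) - e‖ₑ ^ (-δ) ∂μ.toSphere ≤ C := by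
  rcases hδ with rfl | hδ
  · refine ⟨μ.toSphere univ, measure_ne_top _ _, fun e => ?_⟩
    simp
  have hd : (0 : ℝ) < finrank ℝ E := by linarith
  have hd' : 0 < finrank ℝ E := by exact_mod_cast hd
  have : Nontrivial E := nontrivial_of_finrank_pos hd'
  -- Radius `5` suffices: the points `r • ω` used below lie within `2 * τ ≤ 4` of `e`.
  obtain ⟨C, hC, hCe⟩ := lintegral_ball_enorm_sub_rpow_neg μ hd' (β := δ + 1) (by linarith) 5
  refine ⟨2 ^ (δ + 1) * C, ENNReal.mul_ne_top (by simp) hC, fun e => ?_⟩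
  have he : ‖(e : E)‖ = 1 := norm_eq_of_mem_sphere e
  set F : E → ℝ≥0∞ := fun z => (ball (e : E) 5).indicator (fun z => ‖z - e‖ₑ ^ (-(δ + 1))) z with hF
  have hFm : Measurable F := Measurable.indicator (by fun_prop) measurableSet_ball
  have hFint : ∫⁻ z, F z ∂μ = C := by
    rw [hF, lintegral_indicator measurableSet_ball]
    exact hCe e
  have key : ∀ ω : sphere (0 : E) 1, ‖(ω : E) - e‖ₑ ^ (-δ) ≤
      2 ^ (δ + 1) * ∫⁻ r in Ioi (0 : ℝ), ENNReal.ofReal (r ^ (finrank ℝ E - 1)) *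
        F (r • (ω : E)) := by
    intro ω
    have hω : ‖(ω : E)‖ = 1 := norm_eq_of_mem_sphere ω
    set t := ‖(ω : E) - e‖ with ht
    have ht2 : t ≤ 2 := (norm_sub_le _ _).trans (by rw [hω, he]; norm_num)
    have ht0 : 0 ≤ t := norm_nonneg _
    have hen : ‖(ω : E) - e‖ₑ = ENNReal.ofReal t := (ofReal_norm _).symm
    -- A free `τ ≥ t` covers `ω = e` as well, by letting `τ` tend to `0`.
    suffices h : ∀ τ : ℝ, 0 < τ → t ≤ τ → τ ≤ 2 → ENNReal.ofReal τ ^ (-δ) ≤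
        2 ^ (δ + 1) * ∫⁻ r in Ioi (0 : ℝ), ENNReal.ofReal (r ^ (finrank ℝ E - 1)) *
          F (r • (ω : E)) by
      rw [hen]
      rcases ht0.eq_or_lt with ht00 | ht00
      · have hlim : Filter.Tendsto (fun τ : ℝ => ENNReal.ofReal τ ^ (-δ)) (nhdsWithin 0 (Ioi 0))
            (nhds (ENNReal.ofReal 0 ^ (-δ))) := by
          refine Filter.Tendsto.mono_left (Continuous.tendsto ?_ 0) nhdsWithin_le_nhds
          exact ENNReal.continuous_rpow_const.comp ENNReal.continuous_ofReal
        rw [← ht00] at h ⊢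
        refine le_of_tendsto hlim ?_
        filter_upwards [Ioo_mem_nhdsGT (zero_lt_two (α := ℝ))] with τ hτ
        exact h τ hτ.1 hτ.1.le hτ.2.le
      · exact h t ht00 le_rfl ht2
    intro τ hτ0 htτ hτ2
    have hpt : ∀ r ∈ Ioo 1 (1 + τ), (2 * ENNReal.ofReal τ) ^ (-(δ + 1)) ≤
        ENNReal.ofReal (r ^ (finrank ℝ E - 1)) * F (r • (ω : E)) := by
      intro r hr
      have hr1 : 1 ≤ r := hr.1.le
      have h1 : ‖r • (ω : E) - e‖ ≤ 2 * τ := by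
        have : r • (ω : E) - e = (r - 1) • (ω : E) + (ω - e) := by rw [sub_smul, one_smul]; abel
        rw [this]
        refine (norm_add_le _ _).trans ?_
        rw [norm_smul, hω, mul_one, Real.norm_of_nonneg (by linarith)]
        linarith [hr.2]
      have h2 : r • (ω : E) ∈ ball (e : E) 5 := by
        rw [mem_ball, dist_eq_norm]; linarith
      simp only [hF]
      rw [indicator_of_mem h2]
      have h3 : 1 ≤ ENNReal.ofReal (r ^ (finrank ℝ E - 1)) := by
        rw [ENNReal.one_le_ofReal]; exact one_le_pow₀ hr1
      calc (2 * ENNReal.ofReal τ) ^ (-(δ + 1)) ≤ ‖r • (ω : E) - e‖ₑ ^ (-(δ + 1)) := by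
            refine ENNReal.rpow_le_rpow_of_nonpos (by linarith) ?_
            rw [← ofReal_norm, show (2 : ℝ≥0∞) = ENNReal.ofReal 2 by simp,
              ← ENNReal.ofReal_mul (by norm_num)]
            exact ENNReal.ofReal_le_ofReal h1
        _ ≤ _ := le_mul_of_one_le_left zero_le h3
    -- The radial interval has length `τ`, which lowers the exponent by one.
    calc ENNReal.ofReal τ ^ (-δ) = 2 ^ (δ + 1) * ∫⁻ r in Ioo 1 (1 + τ),
          (2 * ENNReal.ofReal τ) ^ (-(δ + 1)) := by
          have h0 : ENNReal.ofReal τ ≠ 0 := by simpa using hτ0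
          rw [setLIntegral_const, Real.volume_Ioo, add_sub_cancel_left,
            ENNReal.mul_rpow_of_ne_top (by simp) (by simp), ← mul_assoc, ← mul_assoc,
            ← ENNReal.rpow_add _ _ (by simp) (by simp), add_neg_cancel, ENNReal.rpow_zero, one_mul]
          nth_rewrite 3 [← ENNReal.rpow_one (ENNReal.ofReal τ)]
          rw [← ENNReal.rpow_add _ _ h0 (by simp)]
          congr 1; ring
      _ ≤ 2 ^ (δ + 1) * ∫⁻ r in Ioo 1 (1 + τ), ENNReal.ofReal (r ^ (finrank ℝ E - 1)) *
          F (r • (ω : E)) := by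
          gcongr 1
          exact setLIntegral_mono' measurableSet_Ioo hpt
      _ ≤ _ := by
          gcongr 1
          exact lintegral_mono_set fun r hr => one_pos.trans hr.1
  have hFm2 : Measurable fun z : sphere (0 : E) 1 × ℝ =>
      ENNReal.ofReal (z.2 ^ (finrank ℝ E - 1)) * F (z.2 • (z.1 : E)) := by fun_prop
  calc ∫⁻ ω : sphere (0 : E) 1, ‖(ω : E) - e‖ₑ ^ (-δ) ∂μ.toSphere
      ≤ ∫⁻ ω : sphere (0 : E) 1, 2 ^ (δ + 1) * (∫⁻ r in Ioi (0 : ℝ),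
          ENNReal.ofReal (r ^ (finrank ℝ E - 1)) * F (r • (ω : E))) ∂μ.toSphere :=
        lintegral_mono key
    _ = 2 ^ (δ + 1) * ∫⁻ z, F z ∂μ := by
        rw [lintegral_const_mul _ hFm2.lintegral_prod_right', lintegral_polar μ hFm,
          lintegral_lintegral_swap hFm2.aemeasurable]
        congr 1
        refine lintegral_congr fun r => ?_
        have hFr : Measurable fun ω : sphere (0 : E) 1 => F (r • (ω : E)) := by fun_prop
        exact lintegral_const_mul (ENNReal.ofReal (r ^ (finrank ℝ E - 1))) hFr
    _ = 2 ^ (δ + 1) * C := by rw [hFint]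

end Polar

/-! ### One-dimensional integrals and the radial kernel -/

theorem ENNReal.rpow_neg_add_of_nonneg {x : ℝ≥0∞} (hx : x ≠ ∞) {γ δ : ℝ} (hγ : 0 ≤ γ)
    (hδ : 0 ≤ δ) : x ^ (-(γ + δ)) = x ^ (-γ) * x ^ (-δ) := by
  rw [ENNReal.rpow_neg, ENNReal.rpow_neg, ENNReal.rpow_neg, ENNReal.rpow_add_of_nonneg _ _ hγ hδ,
    ENNReal.mul_inv (Or.inr (ENNReal.rpow_ne_top_of_nonneg hδ hx))
      (Or.inl (ENNReal.rpow_ne_top_of_nonneg hγ hx))]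

theorem setLIntegral_enorm_rpow_Ioo_lt_top {A R : ℝ} (hA : 0 < A) (hR : 0 < R) :
    ∫⁻ t in Ioo 0 R, ‖t‖ₑ ^ (A - 1) < ∞ := by
  have h1 : IntegrableOn (fun t : ℝ => t ^ (A - 1)) (Ioo 0 R) := by
    rw [intervalIntegral.integrableOn_Ioo_rpow_iff hR]; linarith
  refine lt_of_le_of_lt (le_of_eq ?_) h1.lintegral_lt_top
  refine setLIntegral_congr_fun measurableSet_Ioo fun t ht => ?_
  rw [Real.enorm_of_nonneg ht.1.le, ENNReal.ofReal_rpow_of_pos ht.1]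

theorem setLIntegral_enorm_rpow_Ioi_lt_top {A R : ℝ} (hA : A < -1) (hR : 0 < R) :
    ∫⁻ t in Ioi R, ‖t‖ₑ ^ A < ∞ := by
  refine lt_of_le_of_lt (le_of_eq ?_) (integrableOn_Ioi_rpow_of_lt hA hR).lintegral_lt_top
  refine setLIntegral_congr_fun measurableSet_Ioi fun t ht => ?_
  have ht : 0 < t := hR.trans ht
  rw [Real.enorm_of_nonneg ht.le, ENNReal.ofReal_rpow_of_pos ht]

/-- Convergence at `0` uses `A > 0`, at `1` uses `B < 1`, and at infinity `A < B + D`. -/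
theorem lintegral_Ioi_rpow_mul_sub_one_rpow_lt_top {A B D : ℝ} (hA : 0 < A) (hB0 : 0 ≤ B)
    (hB1 : B < 1) (hD : 0 ≤ D) (h : A < B + D) :
    ∫⁻ t in Ioi (0 : ℝ), ‖t‖ₑ ^ (A - 1) * (‖1 - t‖ₑ ^ (-B) * ‖max 1 t‖ₑ ^ (-D)) < ∞ := by
  set φ : ℝ → ℝ≥0∞ := fun t => ‖t‖ₑ ^ (A - 1) * (‖1 - t‖ₑ ^ (-B) * ‖max 1 t‖ₑ ^ (-D)) with hφ
  have hhalf : ∀ c : ℝ, ((2 : ℝ≥0∞)⁻¹) ^ c ≠ ∞ := fun c =>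
    ENNReal.rpow_ne_top_of_ne_zero (by simp) (by simp)
  have htwo : ∀ c : ℝ, (2 : ℝ≥0∞) ^ c ≠ ∞ := fun c =>
    ENNReal.rpow_ne_top_of_ne_zero (by simp) (by simp)
  have hsub : Ioi (0 : ℝ) ⊆ (Ioo 0 (1 / 2) ∪ Metric.ball 1 2 ∩ Ici (1 / 2)) ∪ Ioi 2 := by
    intro t ht
    have ht : 0 < t := ht
    rcases lt_or_ge t (1 / 2) with h1 | h1
    · exact Or.inl (Or.inl ⟨ht, h1⟩)
    rcases le_or_gt t 2 with h2 | h2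
    · refine Or.inl (Or.inr ⟨?_, h1⟩)
      rw [Metric.mem_ball, Real.dist_eq, abs_lt]
      constructor <;> linarith
    · exact Or.inr h2
  have hmax : ∀ t : ℝ, ‖max 1 t‖ₑ ^ (-D) ≤ 1 := fun t => by
    rw [← ENNReal.one_rpow (-D)]
    refine ENNReal.rpow_le_rpow_of_nonpos (by linarith) ?_
    rw [Real.enorm_of_nonneg (by positivity), ENNReal.one_le_ofReal]
    exact le_max_left _ _
  refine lt_of_le_of_lt ((lintegral_mono_set hsub).trans (lintegral_union_le _ _ _)) ?_
  refine ENNReal.add_lt_top.2 ⟨lt_of_le_of_lt (lintegral_union_le _ _ _)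
    (ENNReal.add_lt_top.2 ⟨?_, ?_⟩), ?_⟩
  · have : ∀ t ∈ Ioo (0 : ℝ) (1 / 2), φ t ≤ (2⁻¹) ^ (-B) * ‖t‖ₑ ^ (A - 1) := fun t ht => by
      rw [hφ, mul_comm ((2⁻¹ : ℝ≥0∞) ^ (-B))]
      refine mul_le_mul_right ?_ _
      refine (mul_le_of_le_one_right zero_le (hmax t)).trans ?_
      refine ENNReal.rpow_le_rpow_of_nonpos (by linarith) ?_
      rw [Real.enorm_of_nonneg (by linarith [ht.2]), show (2 : ℝ≥0∞)⁻¹ = ENNReal.ofReal 2⁻¹ by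
        rw [ENNReal.ofReal_inv_of_pos (by norm_num)]; simp]
      exact ENNReal.ofReal_le_ofReal (by linarith [ht.2])
    refine lt_of_le_of_lt (setLIntegral_mono' measurableSet_Ioo this) ?_
    rw [lintegral_const_mul _ (by fun_prop)]
    exact ENNReal.mul_lt_top (hhalf _).lt_top
      (setLIntegral_enorm_rpow_Ioo_lt_top hA (by norm_num))
  · obtain ⟨C, hC, hCe⟩ := lintegral_ball_enorm_sub_rpow_neg (volume : Measure ℝ) (β := B)
      (by simp) (by simpa using hB1) 2
    have : ∀ t ∈ Metric.ball (1 : ℝ) 2 ∩ Ici (1 / 2),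
        φ t ≤ (4 ^ (A - 1) + (2⁻¹) ^ (A - 1)) * ‖t - 1‖ₑ ^ (-B) := fun t ht => by
      have h1 : (1 / 2 : ℝ) ≤ t := ht.2
      have h2 : t < 3 := by
        have := ht.1
        rw [Metric.mem_ball, Real.dist_eq, abs_lt] at this
        linarith
      have h3 : ‖t‖ₑ ^ (A - 1) ≤ 4 ^ (A - 1) + (2⁻¹) ^ (A - 1) := by
        rw [Real.enorm_of_nonneg (by linarith)]
        rcases le_total 0 (A - 1) with h | h
        · refine le_trans (ENNReal.rpow_le_rpow ?_ h) le_self_add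
          rw [show (4 : ℝ≥0∞) = ENNReal.ofReal 4 by simp]
          exact ENNReal.ofReal_le_ofReal (by linarith)
        · refine le_trans (ENNReal.rpow_le_rpow_of_nonpos h ?_) le_add_self
          rw [show (2 : ℝ≥0∞)⁻¹ = ENNReal.ofReal 2⁻¹ by
            rw [ENNReal.ofReal_inv_of_pos (by norm_num)]; simp]
          exact ENNReal.ofReal_le_ofReal (by linarith)
      have h4 : ‖1 - t‖ₑ = ‖t - 1‖ₑ := enorm_sub_rev 1 t
      simp only [hφ]
      rw [h4]
      exact mul_le_mul' h3 (mul_le_of_le_one_right zero_le (hmax t))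
    refine lt_of_le_of_lt (setLIntegral_mono' (Metric.isOpen_ball.measurableSet.inter
      measurableSet_Ici) this) ?_
    refine lt_of_le_of_lt (lintegral_mono_set inter_subset_left) ?_
    rw [lintegral_const_mul _ (by fun_prop), hCe]
    refine ENNReal.mul_lt_top (ENNReal.add_lt_top.2 ⟨?_, (hhalf _).lt_top⟩) hC.lt_top
    exact (ENNReal.rpow_ne_top_of_ne_zero (by simp) (by simp)).lt_top
  · have : ∀ t ∈ Ioi (2 : ℝ), φ t ≤ (2⁻¹) ^ (-B) * ‖t‖ₑ ^ (A - 1 - B - D) := fun t ht => by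
      have ht : 2 < t := ht
      have ht0 : ‖t‖ₑ ≠ 0 := by simp; linarith
      have h1 : ‖1 - t‖ₑ ^ (-B) ≤ (2⁻¹) ^ (-B) * ‖t‖ₑ ^ (-B) := by
        rw [← ENNReal.mul_rpow_of_ne_top (by simp) (by simp)]
        refine ENNReal.rpow_le_rpow_of_nonpos (by linarith) ?_
        rw [enorm_sub_rev, Real.enorm_of_nonneg (by linarith), Real.enorm_of_nonneg (by linarith),
          show (2 : ℝ≥0∞)⁻¹ = ENNReal.ofReal 2⁻¹ by
            rw [ENNReal.ofReal_inv_of_pos (by norm_num)]; simp, ← ENNReal.ofReal_mul (by norm_num)]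
        exact ENNReal.ofReal_le_ofReal (by linarith)
      simp only [hφ]
      rw [max_eq_right (by linarith : (1 : ℝ) ≤ t)]
      calc _ ≤ ‖t‖ₑ ^ (A - 1) * ((2⁻¹) ^ (-B) * ‖t‖ₑ ^ (-B) * ‖t‖ₑ ^ (-D)) := by gcongr
        _ = (2⁻¹) ^ (-B) * (‖t‖ₑ ^ (A - 1) * ‖t‖ₑ ^ (-B) * ‖t‖ₑ ^ (-D)) := by ring
        _ = _ := by
          rw [← ENNReal.rpow_add _ _ ht0 (by simp), ← ENNReal.rpow_add _ _ ht0 (by simp)]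
          congr 2
    refine lt_of_le_of_lt (setLIntegral_mono' measurableSet_Ioi this) ?_
    rw [lintegral_const_mul _ (by fun_prop)]
    exact ENNReal.mul_lt_top (hhalf _).lt_top
      (setLIntegral_enorm_rpow_Ioi_lt_top (by linarith) (by norm_num))

theorem lintegral_Ioi_comp_mul_left {f : ℝ → ℝ≥0∞} (hf : Measurable f) {R : ℝ} (hR : 0 < R) :
    ∫⁻ t in Ioi (0 : ℝ), f t = ‖R‖ₑ * ∫⁻ t in Ioi (0 : ℝ), f (R * t) := by
  have h1 := setLIntegral_map (μ := volume) (measurableSet_Ioi (a := (0 : ℝ))) hf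
    (measurable_const_mul R)
  have h2 : (fun t => R * t) ⁻¹' Ioi (0 : ℝ) = Ioi 0 := by
    ext t; simp [hR]
  rw [h2, Real.map_volume_mul_left hR.ne', Measure.restrict_smul, lintegral_smul_measure] at h1
  rw [← h1, smul_eq_mul, ← mul_assoc, Real.enorm_of_nonneg hR.le, abs_of_pos (inv_pos.2 hR),
    ← ENNReal.ofReal_mul hR.le, mul_inv_cancel₀ hR.ne', ENNReal.ofReal_one, one_mul]

/-- An upper bound, up to a constant, for the spherical means of `‖x - y‖ ^ (-(γ + δ))`. -/
noncomputable def radialKernel (γ δ R ρ : ℝ) : ℝ≥0∞ :=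
  ‖R - ρ‖ₑ ^ (-γ) * ‖max R ρ‖ₑ ^ (-δ)

theorem radialKernel_comm (γ δ R ρ : ℝ) : radialKernel γ δ R ρ = radialKernel γ δ ρ R := by
  rw [radialKernel, radialKernel, enorm_sub_rev, max_comm]

theorem measurable_radialKernel (γ δ : ℝ) :
    Measurable fun z : ℝ × ℝ => radialKernel γ δ z.1 z.2 := by
  unfold radialKernel; fun_prop

theorem radialKernel_mul (γ δ : ℝ) {R : ℝ} (hR : 0 < R) (t : ℝ) :
    radialKernel γ δ R (R * t) = ‖R‖ₑ ^ (-γ - δ) * radialKernel γ δ 1 t := by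
  have h1 : R - R * t = R * (1 - t) := by ring
  have h2 : max R (R * t) = R * max 1 t := by rw [mul_max_of_nonneg _ _ hR.le, mul_one]
  have h0 : ‖R‖ₑ ≠ 0 := by simpa using hR.ne'
  rw [radialKernel, radialKernel, h1, h2, enorm_mul, enorm_mul,
    ENNReal.mul_rpow_of_ne_top (by simp) (by simp), ENNReal.mul_rpow_of_ne_top (by simp) (by simp),
    sub_eq_add_neg (-γ) δ, ENNReal.rpow_add _ _ h0 (by simp)]
  ring

section

open Module Metric

variable {E : Type*} [NormedAddCommGroup E] [NormedSpace ℝ E] [FiniteDimensional ℝ E]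
  [MeasurableSpace E] [BorelSpace E] (μ : Measure E) [μ.IsAddHaarMeasure]

/-- With `e = y/‖y‖`, the distance `‖R • ω - y‖` is at least `|R - ‖y‖|` and at least half of `max R
‖y‖ * ‖ω - e‖`. The first bound is used with power `γ`, the second with power `δ`, and only the
latter is integrated over the sphere. -/
theorem lintegral_toSphere_le_radialKernel {γ δ : ℝ} (hγ : 0 ≤ γ) (hδ0 : 0 ≤ δ)
    (hδ : δ = 0 ∨ δ < finrank ℝ E - 1) :
    ∃ C : ℝ≥0∞, C ≠ ∞ ∧ ∀ R : ℝ, 0 ≤ R → ∀ y : E, y ≠ 0 →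
      ∫⁻ ω : sphere (0 : E) 1, ‖R • (ω : E) - y‖ₑ ^ (-(γ + δ)) ∂μ.toSphere ≤
        C * radialKernel γ δ R ‖y‖ := by
  obtain ⟨C, hC, hCe⟩ := lintegral_toSphere_enorm_sub_rpow_neg μ hδ0 hδ
  refine ⟨2 ^ δ * C, ENNReal.mul_ne_top (by simp) hC, fun R hR y hy => ?_⟩
  have hy0 : 0 < ‖y‖ := norm_pos_iff.2 hy
  set e : sphere (0 : E) 1 := ⟨‖y‖⁻¹ • y, by simp [norm_smul, hy0.ne']⟩ with he
  have hye : y = ‖y‖ • (e : E) := by simp [he, smul_smul, hy0.ne']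
  have hpt : ∀ ω : sphere (0 : E) 1, ‖R • (ω : E) - y‖ₑ ^ (-(γ + δ)) ≤
      2 ^ δ * radialKernel γ δ R ‖y‖ * ‖(ω : E) - e‖ₑ ^ (-δ) := by
    intro ω
    have hω : ‖(ω : E)‖ = 1 := norm_eq_of_mem_sphere ω
    have hee : ‖(e : E)‖ = 1 := norm_eq_of_mem_sphere e
    have hRω : ‖R • (ω : E)‖ = R := by rw [norm_smul, hω, mul_one, Real.norm_of_nonneg hR]
    have h1 : |R - ‖y‖| ≤ ‖R • (ω : E) - y‖ := by
      have := abs_norm_sub_norm_le (R • (ω : E)) y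
      rwa [hRω] at this
    have h2 : R * ‖(ω : E) - e‖ ≤ 2 * ‖R • (ω : E) - y‖ := by
      have h3 : R • ((ω : E) - e) = (R • (ω : E) - y) - (R - ‖y‖) • (e : E) := by
        rw [sub_smul, ← hye, smul_sub]; abel
      have h4 : ‖R • ((ω : E) - e)‖ ≤ ‖R • (ω : E) - y‖ + |R - ‖y‖| := by
        rw [h3]
        refine (norm_sub_le _ _).trans ?_
        rw [norm_smul (R - ‖y‖), hee, mul_one, Real.norm_eq_abs]
      rw [norm_smul, Real.norm_of_nonneg hR] at h4
      linarith
    have h2' : ‖y‖ * ‖(ω : E) - e‖ ≤ 2 * ‖R • (ω : E) - y‖ := by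
      have h3 : ‖y‖ • ((ω : E) - e) = (R • (ω : E) - y) - (R - ‖y‖) • (ω : E) := by
        rw [sub_smul, smul_sub, ← hye]; abel
      have h4 : ‖‖y‖ • ((ω : E) - e)‖ ≤ ‖R • (ω : E) - y‖ + |R - ‖y‖| := by
        rw [h3]
        refine (norm_sub_le _ _).trans ?_
        rw [norm_smul (R - ‖y‖), hω, mul_one, Real.norm_eq_abs]
      rw [norm_smul, norm_norm] at h4
      linarith
    have h5 : ‖max R ‖y‖‖ₑ * ‖(ω : E) - e‖ₑ ≤ 2 * ‖R • (ω : E) - y‖ₑ := by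
      rw [Real.enorm_of_nonneg (by positivity), ← ofReal_norm, ← ofReal_norm (R • (ω : E) - y),
        show (2 : ℝ≥0∞) = ENNReal.ofReal 2 by simp, ← ENNReal.ofReal_mul (by positivity),
        ← ENNReal.ofReal_mul (by positivity)]
      refine ENNReal.ofReal_le_ofReal ?_
      rw [max_mul_of_nonneg _ _ (norm_nonneg _)]
      exact max_le h2 h2'
    have h6 : ‖R - ‖y‖‖ₑ ≤ ‖R • (ω : E) - y‖ₑ := by
      rw [← ofReal_norm, ← ofReal_norm (R • (ω : E) - y)]
      exact ENNReal.ofReal_le_ofReal h1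
    have h7 : ‖R • (ω : E) - y‖ₑ ^ (-δ) = 2 ^ δ * (2 * ‖R • (ω : E) - y‖ₑ) ^ (-δ) := by
      rw [ENNReal.mul_rpow_of_ne_top (by simp) (by simp), ← mul_assoc,
        ← ENNReal.rpow_add _ _ (by simp) (by simp), add_neg_cancel, ENNReal.rpow_zero, one_mul]
    rw [ENNReal.rpow_neg_add_of_nonneg (by simp) hγ hδ0, h7]
    calc _ ≤ ‖R - ‖y‖‖ₑ ^ (-γ) * (2 ^ δ * (‖max R ‖y‖‖ₑ * ‖(ω : E) - e‖ₑ) ^ (-δ)) := by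
          refine mul_le_mul' (ENNReal.rpow_le_rpow_of_nonpos (by linarith) h6)
            (mul_le_mul_right (ENNReal.rpow_le_rpow_of_nonpos (by linarith) h5) _)
      _ = _ := by
          rw [ENNReal.mul_rpow_of_ne_top (by simp) (by simp), radialKernel]; ring
  calc _ ≤ ∫⁻ ω : sphere (0 : E) 1,
        2 ^ δ * radialKernel γ δ R ‖y‖ * ‖(ω : E) - e‖ₑ ^ (-δ) ∂μ.toSphere := lintegral_mono hpt
    _ = 2 ^ δ * radialKernel γ δ R ‖y‖ * ∫⁻ ω : sphere (0 : E) 1,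
          ‖(ω : E) - e‖ₑ ^ (-δ) ∂μ.toSphere := lintegral_const_mul _ (by fun_prop)
    _ ≤ 2 ^ δ * radialKernel γ δ R ‖y‖ * C := mul_le_mul_right (hCe e) _
    _ = _ := by ring

/-- Because `a + b = γ + δ` the kernel is homogeneous of degree zero, and `‖y‖^(-d) dy`, `d` the
dimension, is dilation invariant, so the integral does not depend on `x`. Convergence at `0`, at `1`
and at infinity comes from `b > 0`, `γ * m < 1` and `a > 0`. -/
theorem lintegral_radialKernel_rpow_le [Nontrivial E] {a b γ δ m : ℝ} (ha : 0 < a) (hb : 0 < b)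
    (hm : 0 < m) (hγ : 0 ≤ γ) (hγm : γ * m < 1) (hδ : 0 ≤ δ) (hab : a + b = γ + δ) :
    ∃ C : ℝ≥0∞, C ≠ ∞ ∧ ∀ x : E, x ≠ 0 →
      ∫⁻ y, (‖x‖ₑ ^ a * radialKernel γ δ ‖x‖ ‖y‖ * ‖y‖ₑ ^ b) ^ m *
        ‖y‖ₑ ^ (-(finrank ℝ E : ℝ)) ∂μ ≤ C := by
  have hJ := lintegral_Ioi_rpow_mul_sub_one_rpow_lt_top (A := b * m) (B := γ * m) (D := δ * m)
    (by positivity) (by positivity) hγm (by positivity) (by rw [← add_mul, ← hab]; nlinarith)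
  set J := ∫⁻ t in Ioi (0 : ℝ), ‖t‖ₑ ^ (b * m - 1) *
    (‖1 - t‖ₑ ^ (-(γ * m)) * ‖max 1 t‖ₑ ^ (-(δ * m))) with hJdef
  refine ⟨μ.toSphere univ * J, ENNReal.mul_ne_top (measure_ne_top _ _) hJ.ne, fun x hx => ?_⟩
  have hR : 0 < ‖x‖ := norm_pos_iff.2 hx
  have hxn : ‖x‖ₑ = ‖(‖x‖ : ℝ)‖ₑ := (enorm_norm x).symm
  rw [hxn]
  set R := ‖x‖
  have hR0 : ‖R‖ₑ ≠ 0 := by simpa using hR.ne'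
  have hrk := measurable_radialKernel γ δ
  have hrk' : Measurable fun ρ => radialKernel γ δ R ρ := hrk.comp measurable_prodMk_left
  have h1 := lintegral_fun_norm μ (f := fun ρ => (‖R‖ₑ ^ a * radialKernel γ δ R ρ * ‖ρ‖ₑ ^ b) ^ m *
        ‖ρ‖ₑ ^ (-(finrank ℝ E : ℝ))) (by fun_prop)
  simp only [enorm_norm] at h1
  rw [h1]
  refine le_of_eq ?_
  congr 1
  have hd : 0 < finrank ℝ E := finrank_pos
  calc _ = ∫⁻ ρ in Ioi (0 : ℝ), (‖R‖ₑ ^ a * radialKernel γ δ R ρ * ‖ρ‖ₑ ^ b) ^ m * ‖ρ‖ₑ⁻¹ := by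
        refine setLIntegral_congr_fun measurableSet_Ioi fun ρ hρ => ?_
        have hρ : 0 < ρ := hρ
        have hρ0 : ‖ρ‖ₑ ≠ 0 := by simpa using hρ.ne'
        rw [mul_left_comm]
        congr 1
        rw [ENNReal.ofReal_pow hρ.le, ← Real.enorm_of_nonneg hρ.le, ← ENNReal.rpow_natCast,
          ← ENNReal.rpow_add _ _ hρ0 (by simp), ← ENNReal.rpow_neg_one, Nat.cast_pred hd]
        congr 1; ring
    _ = ‖R‖ₑ * ∫⁻ t in Ioi (0 : ℝ), (‖R‖ₑ ^ a * radialKernel γ δ R (R * t) * ‖R * t‖ₑ ^ b) ^ m *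
          ‖R * t‖ₑ⁻¹ := lintegral_Ioi_comp_mul_left (by fun_prop) hR
    _ = J := by
        rw [← lintegral_const_mul _ (by fun_prop), hJdef]
        refine setLIntegral_congr_fun measurableSet_Ioi fun t ht => ?_
        have ht : 0 < t := ht
        have ht0 : ‖t‖ₑ ≠ 0 := by simpa using ht.ne'
        have h2 : ‖R‖ₑ ^ a * radialKernel γ δ R (R * t) * ‖R * t‖ₑ ^ b =
            radialKernel γ δ 1 t * ‖t‖ₑ ^ b := by
          rw [radialKernel_mul _ _ hR, enorm_mul, ENNReal.mul_rpow_of_ne_top (by simp) (by simp)]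
          calc _ = (‖R‖ₑ ^ a * ‖R‖ₑ ^ (-γ - δ) * ‖R‖ₑ ^ b) * (radialKernel γ δ 1 t * ‖t‖ₑ ^ b) := by
                ring
            _ = _ := by
                rw [← ENNReal.rpow_add _ _ hR0 (by simp), ← ENNReal.rpow_add _ _ hR0 (by simp),
                  show a + (-γ - δ) + b = 0 by linarith, ENNReal.rpow_zero, one_mul]
        rw [h2, enorm_mul, ENNReal.mul_inv (Or.inl hR0) (Or.inl (by simp)),
          ENNReal.mul_rpow_of_nonneg _ _ hm.le, radialKernel, ENNReal.mul_rpow_of_nonneg _ _ hm.le,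
          ← ENNReal.rpow_mul, ← ENNReal.rpow_mul, ← ENNReal.rpow_mul]
        calc _ = (‖R‖ₑ * ‖R‖ₑ⁻¹) * (‖t‖ₑ ^ (b * m) * ‖t‖ₑ⁻¹ * (‖1 - t‖ₑ ^ (-γ * m) *
              ‖max 1 t‖ₑ ^ (-δ * m))) := by ring
          _ = _ := by
              rw [ENNReal.mul_inv_cancel hR0 (by simp), one_mul, ← ENNReal.rpow_neg_one,
                ← ENNReal.rpow_add _ _ ht0 (by simp), neg_mul, neg_mul, sub_eq_add_neg (b * m)]

end

/-! ### Weighted estimates for radial functions -/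

section

open Module Metric

variable {E : Type*} [NormedAddCommGroup E] [NormedSpace ℝ E] [FiniteDimensional ℝ E]
  [MeasurableSpace E] [BorelSpace E] (μ : Measure E) [μ.IsAddHaarMeasure]

/-- The spherical integral needs `δ < d - 1`, that is `γ > 1 - σ`, while Young's inequality needs `γ
< θ`. If `d - σ < θ` no averaging gain is needed and `δ = 0`; otherwise `γ` is the midpoint of the
admissible range. -/
theorem exists_radialKernel_exponents {d σ θ : ℝ} (hσ : σ < d) (hθ : 0 < θ) (h : 1 - σ < θ) :
    ∃ γ δ : ℝ, 0 ≤ γ ∧ γ < θ ∧ 0 ≤ δ ∧ (δ = 0 ∨ δ < d - 1) ∧ γ + δ = d - σ := by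
  rcases lt_or_ge (d - σ) θ with h1 | h1
  · exact ⟨d - σ, 0, by linarith, h1, le_rfl, Or.inl rfl, by ring⟩
  · have h2 : max 0 (1 - σ) < θ := max_lt hθ h
    have h3 : 0 ≤ max 0 (1 - σ) := le_max_left _ _
    have h4 : 1 - σ ≤ max 0 (1 - σ) := le_max_right _ _
    refine ⟨(max 0 (1 - σ) + θ) / 2, d - σ - (max 0 (1 - σ) + θ) / 2, ?_, ?_, ?_, Or.inr ?_, ?_⟩ <;>
      linarith

/-- A radial function dominated by a Riesz potential of `g` is dominated by an integral operator
with a radial kernel applied to `g`. -/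
theorem ae_le_lintegral_radialKernel [Nontrivial E] {γ δ : ℝ} (hγ : 0 ≤ γ) (hδ0 : 0 ≤ δ)
    (hδ : δ = 0 ∨ δ < finrank ℝ E - 1) :
    ∃ C : ℝ≥0∞, C ≠ ∞ ∧ ∀ (w : ℝ → ℝ≥0∞) (g : E → ℝ≥0∞), Measurable g →
      (∀ᵐ x ∂μ, w ‖x‖ ≤ ∫⁻ y, ‖x - y‖ₑ ^ (-(γ + δ)) * g y ∂μ) →
      ∀ᵐ x ∂μ, w ‖x‖ ≤ C * ∫⁻ y, radialKernel γ δ ‖x‖ ‖y‖ * g y ∂μ := by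
  obtain ⟨C, hC, hCb⟩ := lintegral_toSphere_le_radialKernel μ hγ hδ0 hδ
  have hS0 : μ.toSphere univ ≠ 0 := by
    rw [Ne, Measure.measure_univ_eq_zero]; exact Measure.toSphere_ne_zero μ
  refine ⟨(μ.toSphere univ)⁻¹ * C, ENNReal.mul_ne_top (ENNReal.inv_ne_top.2 hS0) hC,
    fun w g hg hw => ?_⟩
  filter_upwards [ae_mul_le_lintegral_toSphere μ hw] with x hx
  have hrk := measurable_radialKernel γ δ
  have hrkx : Measurable fun y : E => radialKernel γ δ ‖x‖ ‖y‖ :=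
    hrk.comp (measurable_const.prodMk measurable_norm)
  have hmeas : Measurable fun z : sphere (0 : E) 1 × E =>
      ‖‖x‖ • (z.1 : E) - z.2‖ₑ ^ (-(γ + δ)) * g z.2 := by fun_prop
  have hle : μ.toSphere univ * w ‖x‖ ≤ C * ∫⁻ y, radialKernel γ δ ‖x‖ ‖y‖ * g y ∂μ := by
    refine hx.trans ?_
    rw [lintegral_lintegral_swap hmeas.aemeasurable, ← lintegral_const_mul _ (by fun_prop)]
    refine lintegral_mono_ae ?_
    filter_upwards [Measure.ae_ne μ (0 : E)] with y hy
    have hy' : Measurable fun ω : sphere (0 : E) 1 => ‖‖x‖ • (ω : E) - y‖ₑ ^ (-(γ + δ)) := by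
      fun_prop
    calc _ = (∫⁻ ω : sphere (0 : E) 1, ‖‖x‖ • (ω : E) - y‖ₑ ^ (-(γ + δ)) ∂μ.toSphere) * g y :=
          lintegral_mul_const (g y) hy'
      _ ≤ C * radialKernel γ δ ‖x‖ ‖y‖ * g y := by
          gcongr
          exact hCb _ (norm_nonneg x) y hy
      _ = _ := mul_assoc _ _ _
  calc w ‖x‖ = (μ.toSphere univ)⁻¹ * (μ.toSphere univ * w ‖x‖) := by
        rw [← mul_assoc, ENNReal.inv_mul_cancel hS0 (measure_ne_top _ _), one_mul]
    _ ≤ (μ.toSphere univ)⁻¹ * (C * ∫⁻ y, radialKernel γ δ ‖x‖ ‖y‖ * g y ∂μ) := by gcongr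
    _ = _ := (mul_assoc _ _ _).symm

/-- This is Young's inequality for `‖x‖^(-d) dx` in both variables, `d` the dimension. The weight
`‖y‖^(d/p)` on `g` converts its `L^p` norm to that measure, which forces the value of `b`. -/
theorem lintegral_rpow_radialKernel_le [Nontrivial E] {p q m a b γ δ : ℝ} (hp : 1 < p)
    (hpq : p ≤ q) (hm : 1 / m = 1 + 1 / q - 1 / p) (ha : 0 < a)
    (hb : b = finrank ℝ E - finrank ℝ E / p)
    (hab : a + b = γ + δ) (hγ : 0 ≤ γ) (hγm : γ < 1 / m) (hδ : 0 ≤ δ) :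
    ∃ C : ℝ≥0∞, C ≠ ∞ ∧ ∀ g : E → ℝ≥0∞, Measurable g →
      ∫⁻ x, (∫⁻ y, radialKernel γ δ ‖x‖ ‖y‖ * g y ∂μ) ^ q *
        ‖x‖ₑ ^ (a * q - finrank ℝ E) ∂μ ≤ C * (∫⁻ y, g y ^ p ∂μ) ^ (q / p) := by
  obtain ⟨d, hd⟩ : ∃ d : ℝ, d = finrank ℝ E := ⟨_, rfl⟩
  rw [← hd] at hb ⊢
  have hd0 : 0 < d := by rw [hd]; exact_mod_cast finrank_pos
  have hp0 : 0 < p := by linarith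
  have hq0 : 0 < q := by linarith
  have hm0 : 0 < m := by
    refine one_div_pos.1 ?_
    have : 1 / p < 1 := by rw [div_lt_one hp0]; exact hp
    have : 0 < 1 / q := by positivity
    linarith
  have hb0 : 0 < b := by
    rw [hb, sub_pos, div_lt_iff₀ hp0]; nlinarith
  have hγm' : γ * m < 1 := by rwa [lt_div_iff₀ hm0] at hγm
  -- By symmetry of the kernel, the two Schur bounds are one lemma with `a` and `b` exchanged.
  obtain ⟨C₁, hC₁, hC₁b⟩ := lintegral_radialKernel_rpow_le μ ha hb0 hm0 hγ hγm' hδ hab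
  obtain ⟨C₂, hC₂, hC₂b⟩ := lintegral_radialKernel_rpow_le μ hb0 ha hm0 hγ hγm' hδ
    (by rw [add_comm, hab])
  rw [← hd] at hC₁b hC₂b
  have hrk := measurable_radialKernel γ δ
  have hrk2 : Measurable fun z : E × E => radialKernel γ δ ‖z.1‖ ‖z.2‖ :=
    hrk.comp (by fun_prop : Measurable fun z : E × E => (‖z.1‖, ‖z.2‖))
  set ν : Measure E := μ.withDensity fun x => ‖x‖ₑ ^ (-d) with hν
  have hρ : Measurable fun x : E => ‖x‖ₑ ^ (-d) := by fun_prop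
  set K : E → E → ℝ≥0∞ := fun x y => ‖x‖ₑ ^ a * radialKernel γ δ ‖x‖ ‖y‖ * ‖y‖ₑ ^ b with hK
  have hKm : Measurable (Function.uncurry K) := by
    change Measurable fun z : E × E => ‖z.1‖ₑ ^ a * radialKernel γ δ ‖z.1‖ ‖z.2‖ * ‖z.2‖ₑ ^ b
    fun_prop
  have hne : ∀ᵐ x ∂ν, x ≠ 0 :=
    (withDensity_absolutelyContinuous μ _).ae_le (Measure.ae_ne μ (0 : E))
  have hνint : ∀ f : E → ℝ≥0∞, Measurable f → ∫⁻ x, f x ∂ν = ∫⁻ x, f x * ‖x‖ₑ ^ (-d) ∂μ := by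
    intro f hf
    rw [hν, lintegral_withDensity_eq_lintegral_mul _ hρ hf]
    exact lintegral_congr fun x => mul_comm _ _
  refine ⟨(max C₁ C₂) ^ (q / m), ENNReal.rpow_ne_top_of_nonneg (by positivity)
    (max_lt hC₁.lt_top hC₂.lt_top).ne, fun g hg => ?_⟩
  set h : E → ℝ≥0∞ := fun y => ‖y‖ₑ ^ (d / p) * g y with hh
  have hhm : Measurable h := by fun_prop
  have schur := lintegral_rpow_lintegral_mul_le (μ := ν) (ν := ν) hp hpq hm hKm hhm
    (B := max C₁ C₂) (by
      filter_upwards [hne] with x hx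
      rw [hνint _ (hKm.of_uncurry_left.pow_const m)]
      exact (hC₁b x hx).trans (le_max_left _ _)) (by
      filter_upwards [hne] with y hy
      rw [hνint _ (hKm.of_uncurry_right.pow_const m)]
      refine le_trans (le_of_eq ?_) ((hC₂b y hy).trans (le_max_right _ _))
      refine lintegral_congr fun x => ?_
      simp only [hK]
      rw [radialKernel_comm γ δ ‖y‖]
      ring_nf)
  have hr : ∀ x y : E, y ≠ 0 → K x y * h y * ‖y‖ₑ ^ (-d) =
      ‖x‖ₑ ^ a * (radialKernel γ δ ‖x‖ ‖y‖ * g y) := by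
    intro x y hy
    have hy0 : ‖y‖ₑ ≠ 0 := by simpa using hy
    calc _ = ‖x‖ₑ ^ a * (radialKernel γ δ ‖x‖ ‖y‖ * g y) *
          (‖y‖ₑ ^ b * ‖y‖ₑ ^ (d / p) * ‖y‖ₑ ^ (-d)) := by simp only [hK, hh]; ring
      _ = _ := by
          rw [← ENNReal.rpow_add _ _ hy0 (by simp), ← ENNReal.rpow_add _ _ hy0 (by simp), hb,
            show d - d / p + d / p + -d = 0 by ring, ENNReal.rpow_zero, mul_one]
  have hKh : ∀ x, ∫⁻ y, K x y * h y ∂ν =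
      ‖x‖ₑ ^ a * ∫⁻ y, radialKernel γ δ ‖x‖ ‖y‖ * g y ∂μ := by
    intro x
    have hrkx : Measurable fun y : E => radialKernel γ δ ‖x‖ ‖y‖ :=
      hrk.comp (measurable_const.prodMk measurable_norm)
    rw [hνint (fun y => K x y * h y) (hKm.of_uncurry_left.mul hhm),
      ← lintegral_const_mul _ (by fun_prop)]
    refine lintegral_congr_ae ?_
    filter_upwards [Measure.ae_ne μ (0 : E)] with y hy using hr x y hy
  have hhp : ∫⁻ y, h y ^ p ∂ν = ∫⁻ y, g y ^ p ∂μ := by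
    rw [hνint _ (hhm.pow_const p)]
    refine lintegral_congr_ae ?_
    filter_upwards [Measure.ae_ne μ (0 : E)] with y hy
    have hy0 : ‖y‖ₑ ≠ 0 := by simpa using hy
    simp only [hh]
    rw [ENNReal.mul_rpow_of_nonneg _ _ hp0.le, ← ENNReal.rpow_mul, div_mul_cancel₀ _ hp0.ne',
      mul_right_comm, ← ENNReal.rpow_add _ _ hy0 (by simp), add_neg_cancel, ENNReal.rpow_zero,
      one_mul]
  rw [hhp] at schur
  refine le_trans (le_of_eq ?_) schur
  have hTm : Measurable fun x : E => ∫⁻ y, radialKernel γ δ ‖x‖ ‖y‖ * g y ∂μ :=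
    Measurable.lintegral_prod_right' (f := fun z : E × E => radialKernel γ δ ‖z.1‖ ‖z.2‖ * g z.2)
      (by fun_prop)
  simp only [hKh]
  rw [hνint _ (by fun_prop)]
  refine lintegral_congr_ae ?_
  filter_upwards [Measure.ae_ne μ (0 : E)] with x hx
  have hx0 : ‖x‖ₑ ≠ 0 := by simpa using hx
  rw [ENNReal.mul_rpow_of_nonneg _ _ hq0.le, ← ENNReal.rpow_mul, sub_eq_add_neg,
    ENNReal.rpow_add _ _ hx0 (by simp)]
  ring

/-- Weighted `L^p`-`L^q` estimate for radial functions dominated by a Riesz potential. -/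
theorem lintegral_rpow_le_of_radial_of_le_riesz [Nontrivial E] {σ p q c : ℝ} (hp : 1 < p)
    (hpq : p ≤ q) (hσ : σ < finrank ℝ E) (hc : 0 < finrank ℝ E + c)
    (hscale : (finrank ℝ E + c) / q = finrank ℝ E / p - σ) (hσpq : 1 / p - 1 / q < σ) :
    ∃ C : ℝ≥0∞, C ≠ ∞ ∧ ∀ (w : ℝ → ℝ≥0∞) (g : E → ℝ≥0∞), Measurable g →
      (∀ᵐ x ∂μ, w ‖x‖ ≤ ∫⁻ y, ‖x - y‖ₑ ^ (σ - finrank ℝ E) * g y ∂μ) →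
      ∫⁻ x, w ‖x‖ ^ q * ‖x‖ₑ ^ c ∂μ ≤ C * (∫⁻ y, g y ^ p ∂μ) ^ (q / p) := by
  have hp0 : 0 < p := by linarith
  have hq0 : 0 < q := by linarith
  have h1p : 1 / p < 1 := by rw [div_lt_one hp0]; exact hp
  have h1q : 0 < 1 / q := by positivity
  -- Here `θ` is `1/m` in Young's inequality, and `1 - σ < θ` is `hσpq`.
  obtain ⟨γ, δ, hγ, hγm, hδ0, hδ, hγδ⟩ := exists_radialKernel_exponents (d := finrank ℝ E)
    (θ := 1 + 1 / q - 1 / p) hσ (by linarith) (by linarith)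
  obtain ⟨C₁, hC₁, hC₁b⟩ := ae_le_lintegral_radialKernel μ hγ hδ0 hδ
  -- This `a` makes the weight exponent `a * q - d` equal to `c`; `hscale` then gives `a + b = γ +
  -- δ`.
  obtain ⟨C₂, hC₂, hC₂b⟩ := lintegral_rpow_radialKernel_le μ (m := (1 + 1 / q - 1 / p)⁻¹)
    (a := (finrank ℝ E + c) / q) (γ := γ) (δ := δ) hp hpq (by rw [one_div, inv_inv])
    (by positivity) rfl (by rw [hγδ, hscale]; ring) hγ (by rwa [one_div, inv_inv]) hδ0
  refine ⟨C₁ ^ q * C₂, ENNReal.mul_ne_top (ENNReal.rpow_ne_top_of_nonneg hq0.le hC₁) hC₂,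
    fun w g hg hw => ?_⟩
  rw [show σ - finrank ℝ E = -(γ + δ) by rw [hγδ]; ring] at hw
  have hT := hC₂b g hg
  rw [div_mul_cancel₀ _ hq0.ne', add_sub_cancel_left] at hT
  calc ∫⁻ x, w ‖x‖ ^ q * ‖x‖ₑ ^ c ∂μ
      ≤ ∫⁻ x, C₁ ^ q * ((∫⁻ y, radialKernel γ δ ‖x‖ ‖y‖ * g y ∂μ) ^ q * ‖x‖ₑ ^ c) ∂μ := by
        refine lintegral_mono_ae ?_
        filter_upwards [hC₁b w g hg hw] with x hx
        rw [← mul_assoc, ← ENNReal.mul_rpow_of_nonneg _ _ hq0.le]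
        gcongr
    _ = C₁ ^ q * ∫⁻ x, (∫⁻ y, radialKernel γ δ ‖x‖ ‖y‖ * g y ∂μ) ^ q * ‖x‖ₑ ^ c ∂μ :=
        lintegral_const_mul' _ _ (ENNReal.rpow_ne_top_of_nonneg hq0.le hC₁)
    _ ≤ _ := by
        rw [mul_assoc]
        gcongr

end

/-! ### Return to Bessel potentials -/

theorem enorm_besselPotential_le (n : ℕ) (s : ℝ) (f : EuclideanSpace ℝ (Fin n) → ℂ)
    (x : EuclideanSpace ℝ (Fin n)) :
    ‖besselPotential n s f x‖ₑ ≤ ∫⁻ y, ‖besselKernel n s (x - y)‖ₑ * ‖f y‖ₑ := by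
  rw [← lintegral_sub_left_eq_self _ x, besselPotential, convolution]
  refine (enorm_integral_le_lintegral_enorm _).trans (le_of_eq (lintegral_congr fun t => ?_))
  rw [sub_sub_cancel, ContinuousLinearMap.lsmul_apply, enorm_smul]

theorem aestronglyMeasurable_besselPotential {n : ℕ} (s : ℝ) {f : EuclideanSpace ℝ (Fin n) → ℂ}
    (hf : AEStronglyMeasurable f volume) :
    AEStronglyMeasurable (besselPotential n s f) volume :=
  (AEStronglyMeasurable.convolution_integrand (ContinuousLinearMap.lsmul ℝ ℝ)
    (measurable_besselKernel n s).aestronglyMeasurable hf).integral_prod_right'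

/-- The real and extended powers of `‖x‖` can differ only at the origin, a null set. An inequality
suffices and spares measurability of `f`. -/
theorem lintegral_powerWeight_le (n : ℕ) [NeZero n] (c : ℝ) (f : EuclideanSpace ℝ (Fin n) → ℝ≥0∞) :
    ∫⁻ x, f x ∂(powerWeight n c) ≤ ∫⁻ x, f x * ‖x‖ₑ ^ c := by
  refine (lintegral_withDensity_le_lintegral_mul _ (by fun_prop) f).trans (lintegral_mono_ae ?_)
  filter_upwards [Measure.ae_ne volume (0 : EuclideanSpace ℝ (Fin n))] with x hx
  rw [Pi.mul_apply, mul_comm, ← ENNReal.ofReal_rpow_of_pos (norm_pos_iff.2 hx), ofReal_norm]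

theorem eLpNorm_powerWeight_le {n : ℕ} {p s r c : ℝ} (hp : 1 < p) (hs : 0 < s) (hsn : s < n / p)
    (hpr : p ≤ r) (hr : r ≤ p * (n + c) / (n - s * p))
    (hc : -(s * p) < c) (hc' : c < (n - 1) * (r - p) / p) :
    ∃ C : ℝ≥0∞, C ≠ ∞ ∧ ∀ u f : EuclideanSpace ℝ (Fin n) → ℂ, IsRadial u →
      AEStronglyMeasurable f volume → u =ᵐ[volume] besselPotential n s f →
      eLpNorm u (ENNReal.ofReal r) (powerWeight n c) ≤
        C * eLpNorm f (ENNReal.ofReal p) volume := by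
  have hp0 : 0 < p := by linarith
  have hr0 : 0 < r := by linarith
  have hspn : s * p < n := by rwa [lt_div_iff₀ hp0] at hsn
  have hn0 : (0 : ℝ) < n := lt_trans (by positivity) hspn
  have : NeZero n := ⟨by rintro rfl; simp at hn0⟩
  have hnc : (0 : ℝ) < n + c := by linarith
  have hcp : c * p < (n - 1) * (r - p) := by rwa [lt_div_iff₀ hp0] at hc'
  have hr' : r * (n - s * p) ≤ p * (n + c) := by rwa [le_div_iff₀ (by linarith)] at hr
  -- Scaling forces this order. The bound on `r` gives `σ ≤ s`, positivity of `n + c` gives `σ < n`,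
  -- and the upper bound on `c` gives `1/p - 1/r < σ`.
  set σ : ℝ := n / p - (n + c) / r with hσ
  have hσs : σ ≤ s := by
    have : (n - s * p) / p ≤ (n + c) / r := by
      rw [div_le_div_iff₀ hp0 hr0]; linarith
    have h2 : (n - s * p) / p = n / p - s := by field_simp
    rw [hσ]; linarith
  have hσn : σ < n := by
    have h1 : 0 < (n + c) / r := by positivity
    have h2 : n / p < (n : ℝ) := div_lt_self hn0 hp
    rw [hσ]; linarith
  have hσpq : 1 / p - 1 / r < σ := by
    have h1 : σ - (1 / p - 1 / r) = ((n - 1) * (r - p) - c * p) / (p * r) := by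
      rw [hσ]; field_simp; ring
    have h2 : 0 < ((n - 1) * (r - p) - c * p) / (p * r) := div_pos (by linarith) (by positivity)
    linarith
  have hfin : Module.finrank ℝ (EuclideanSpace ℝ (Fin n)) = n := finrank_euclideanSpace_fin
  obtain ⟨A, hA⟩ := enorm_besselKernel_le hσs hσn
  obtain ⟨C, hC, hCb⟩ := lintegral_rpow_le_of_radial_of_le_riesz
    (volume : Measure (EuclideanSpace ℝ (Fin n))) (σ := σ) (c := c) hp hpr (by rwa [hfin])
    (by rwa [hfin]) (by rw [hfin, hσ]; ring) hσpq
  rw [hfin] at hCb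
  have hA0 : ((A + 1 : ℝ≥0) : ℝ≥0∞) ≠ ∞ := ENNReal.coe_ne_top
  refine ⟨C ^ (1 / r) * (A + 1 : ℝ≥0), ENNReal.mul_ne_top
    (ENNReal.rpow_ne_top_of_nonneg (by positivity) hC) hA0, fun u f hu hf huf => ?_⟩
  obtain ⟨u₀, hu₀⟩ := hu
  have hgm : Measurable fun y => ((A + 1 : ℝ≥0) : ℝ≥0∞) * ‖hf.mk f y‖ₑ :=
    (hf.stronglyMeasurable_mk.measurable.enorm).const_mul _
  have hdom : ∀ᵐ x : EuclideanSpace ℝ (Fin n), ‖u₀ ‖x‖‖ₑ ≤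
      ∫⁻ y, ‖x - y‖ₑ ^ (σ - n) * (((A + 1 : ℝ≥0) : ℝ≥0∞) * ‖hf.mk f y‖ₑ) := by
    filter_upwards [hu₀, huf] with x h1 h2
    rw [← h1, h2]
    refine (enorm_besselPotential_le n s f x).trans (lintegral_mono_ae ?_)
    filter_upwards [hf.ae_eq_mk] with y hy
    rw [← hy, ← mul_assoc, mul_comm (_ ^ _)]
    gcongr
    exact hA _
  have key := hCb (fun t => ‖u₀ t‖ₑ) _ hgm hdom
  have hr1 : ENNReal.ofReal r ≠ 0 := by simpa using hr0
  have hp1 : ENNReal.ofReal p ≠ 0 := by simpa using hp0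
  have hu_int : ∫⁻ x, ‖u x‖ₑ ^ r ∂(powerWeight n c) ≤
      ∫⁻ x : EuclideanSpace ℝ (Fin n), ‖u₀ ‖x‖‖ₑ ^ r * ‖x‖ₑ ^ c := by
    refine (lintegral_powerWeight_le n c _).trans (lintegral_mono_ae ?_)
    filter_upwards [hu₀] with x hx
    rw [hx]
  have hg_int : ∫⁻ y, (((A + 1 : ℝ≥0) : ℝ≥0∞) * ‖hf.mk f y‖ₑ) ^ p =
      ((A + 1 : ℝ≥0) : ℝ≥0∞) ^ p * ∫⁻ y, ‖f y‖ₑ ^ p := by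
    rw [← lintegral_const_mul' _ _ (ENNReal.rpow_ne_top_of_nonneg hp0.le hA0)]
    refine lintegral_congr_ae ?_
    filter_upwards [hf.ae_eq_mk] with y hy
    rw [← hy, ENNReal.mul_rpow_of_nonneg _ _ hp0.le]
  rw [eLpNorm_eq_lintegral_rpow_enorm_toReal hr1 ENNReal.ofReal_ne_top,
    eLpNorm_eq_lintegral_rpow_enorm_toReal hp1 ENNReal.ofReal_ne_top,
    ENNReal.toReal_ofReal hr0.le, ENNReal.toReal_ofReal hp0.le]
  rw [hg_int] at key
  calc (∫⁻ x, ‖u x‖ₑ ^ r ∂(powerWeight n c)) ^ (1 / r)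
      ≤ (C * (((A + 1 : ℝ≥0) : ℝ≥0∞) ^ p * ∫⁻ y, ‖f y‖ₑ ^ p) ^ (r / p)) ^ (1 / r) :=
        ENNReal.rpow_le_rpow (hu_int.trans key) (by positivity)
    _ = _ := by
        rw [ENNReal.mul_rpow_of_nonneg _ _ (by positivity), ← ENNReal.rpow_mul,
          show r / p * (1 / r) = 1 / p by field_simp,
          ENNReal.mul_rpow_of_nonneg _ _ (by positivity), ← ENNReal.rpow_mul,
          mul_one_div_cancel hp0.ne', ENNReal.rpow_one, mul_assoc]

theorem mainTheorem1 (n : ℕ) (p s r c : ℝ) (hp : 1 < p) (hs : 0 < s) (hsn : s < n / p)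
    (hpr : p ≤ r) (hr : r ≤ p * (n + c) / (n - s * p))
    (hc : -(s * p) < c) (hc' : c < (n - 1) * (r - p) / p) :
    ∃ C : ℝ≥0, ∀ u ∈ radialPotentialSpace n s (ENNReal.ofReal p),
      MemLp u (ENNReal.ofReal r) (powerWeight n c) ∧
      eLpNorm u (ENNReal.ofReal r) (powerWeight n c) ≤
        C * potentialNorm n s (ENNReal.ofReal p) u := by
  obtain ⟨C, hC, hCb⟩ := eLpNorm_powerWeight_le hp hs hsn hpr hr hc hc'
  refine ⟨C.toNNReal, fun u hu => ?_⟩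
  obtain ⟨⟨f, hf, huf⟩, hrad⟩ := hu
  have hac : powerWeight n c ≪ volume := withDensity_absolutelyContinuous _ _
  refine ⟨⟨?_, ?_⟩, ?_⟩
  · exact ((aestronglyMeasurable_besselPotential s hf.1).congr huf.symm).mono_ac hac
  · exact (hCb u f hrad hf.1 huf).trans_lt (ENNReal.mul_lt_top hC.lt_top hf.2)
  · rw [ENNReal.coe_toNNReal hC, potentialNorm]
    rcases eq_or_ne C 0 with h0 | h0
    · have := hCb u f hrad hf.1 huf
      rw [h0, zero_mul] at this ⊢
      exact this
    -- Dividing by `C` lets the estimate, valid for every representative, pass to the infimum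
    -- defining the norm.
    rw [← ENNReal.div_le_iff' h0 hC]
    refine le_iInf fun f' => le_iInf fun hf' => le_iInf fun huf' => ?_
    rw [ENNReal.div_le_iff' h0 hC]
    exact hCb u f' hrad hf'.1 huf'
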